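/- Let $R$ be an associative ring with $1$; all modules are left $R$-modules. A pp formula in variables $\bar x=(x_1,\dots,x_n)$ is a formula $\exists \bar y\,(A\bar x+B\bar y=0)$ with $\bar y$ a finite tuple of variables and $A,B$ finite matrices over $R$; for a module $M$ write $\phi(M)\subseteq M^n$ for the set of tuples satisfying $\phi$ in $M$, and $\mathrm{pp}_M(\bar a)=\{\phi : \bar a\in\phi(M)\}$ for the pp type of a tuple $\bar a$ in $M$. An embedding $M\subseteq N$ is pure if $\phi(N)\cap M^n=\phi(M)$ for every $n$ and every pp formula $\phi$ in $n$ variables; a module is absolutely pure if each of its embeddings into a module is pure, and $_R\sharp$ denotes the class of absolutely pure modules. For a class $\mathcal L$ of modules and pp formulas $\psi,\phi$ in the same variables, write $\psi\le_{\mathcal L}\phi$ if $\psi(L)\subseteq\phi(L)$ for all $L\in\mathcal L$. Two pp types $p,q$ are $\mathcal L$-equivalent if for every $\phi\in q$ there is $\psi\in p$ with $\psi\le_{\mathcal L}\phi$, and for every $\phi\in p$ there is $\psi\in q$ with $\psi\le_{\mathcal L}\phi$. An embedding $M\subseteq N$ is $\mathcal L$-pure if for every finite tuple $\bar a$ in $M$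 the pp types $\mathrm{pp}_M(\bar a)$ and $\mathrm{pp}_N(\bar a)$ are $\mathcal L$-equivalent. **Lemma.** If $R$ is left coherent (every finitely generated left ideal of $R$ is finitely presented), then every embedding of left $R$-modules is $_R\sharp$-pure. -/

import Mathlib

universe u v

/-- `R` is left coherent: every finitely generated left ideal is finitely presented
(`Ideal R` is the type of left ideals). -/
def IsLeftCoherent (R : Type u) [Ring R] : Prop :=
  ∀ I : Ideal R, I.FG → Module.FinitePresentation R I

/-- A positive primitive formula in `n` free variables `x` in the language of left `R`-modules:
`∃ y, A x + B y = 0`, with `y` a tuple of `numEx` variables and `numEq` linear equations. -/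
structure PPFormula (R : Type u) (n : ℕ) where
  /-- the number of existentially quantified variables -/
  numEx : ℕ
  /-- the number of equations -/
  numEq : ℕ
  /-- the coefficients of the free variables -/
  A : Matrix (Fin numEq) (Fin n) R
  /-- the coefficients of the quantified variables -/
  B : Matrix (Fin numEq) (Fin numEx) R

/-- The tuple `x` in the module `M` satisfies `φ`, that is, `x ∈ φ(M)`. -/
def PPFormula.Holds {R : Type u} [Ring R] {n : ℕ} (φ : PPFormula R n)
    {M : Type v} [AddCommGroup M] [Module R M] (x : Fin n → M) : Prop :=
  ∃ y : Fin φ.numEx → M, ∀ i : Fin φ.numEq,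
    ∑ j, φ.A i j • x j + ∑ k, φ.B i k • y k = 0

/-- The pp type of a tuple in a module: all pp formulas which it satisfies there. -/
def ppType (R : Type u) [Ring R] {n : ℕ} {M : Type v} [AddCommGroup M] [Module R M]
    (x : Fin n → M) : Set (PPFormula R n) :=
  {φ | φ.Holds x}

/-- The map `f : M → N` is a pure embedding: it is injective, and pp formulas satisfied in `N` by (the image of) a
tuple of `M` are already satisfied in `M`. -/
def IsPureEmbedding {R : Type u} [Ring R] {M N : Type v} [AddCommGroup M] [Module R M]
    [AddCommGroup N] [Module R N] (f : M →ₗ[R] N) : Prop :=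
  Function.Injective f ∧
    ∀ (n : ℕ) (a : Fin n → M) (φ : PPFormula R n), φ.Holds (fun i => f (a i)) → φ.Holds a

/-- The class of absolutely pure left `R`-modules: those `M` for which every embedding of `M` into
a left `R`-module is pure. -/
def absolutelyPureModules (R : Type u) [Ring R] : Set (ModuleCat.{v} R) :=
  {M | ∀ (N : ModuleCat.{v} R) (f : M →ₗ[R] N), Function.Injective f → IsPureEmbedding f}

/-- `ψ ≤ φ` relative to a class `𝓛` of modules: `ψ(L) ⊆ φ(L)` for all `L` in `𝓛`. -/
def PPFormula.LeOn {R : Type u} [Ring R] {n : ℕ} (𝓛 : Set (ModuleCat.{v} R))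
    (ψ φ : PPFormula R n) : Prop :=
  ∀ L ∈ 𝓛, ∀ x : Fin n → L, ψ.Holds x → φ.Holds x

/-- `p ≤ q` relative to `𝓛` for pp types `p`, `q`: each formula of `q` is implied on `𝓛` by
a formula of `p`. (A pp type is closed under finite conjunctions, so one formula suffices.) -/
def PPTypeLeOn {R : Type u} [Ring R] {n : ℕ} (𝓛 : Set (ModuleCat.{v} R))
    (p q : Set (PPFormula R n)) : Prop :=
  ∀ φ ∈ q, ∃ ψ ∈ p, ψ.LeOn 𝓛 φ

/-- `𝓛`-equivalence of pp types. -/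
def PPTypeEquivOn {R : Type u} [Ring R] {n : ℕ} (𝓛 : Set (ModuleCat.{v} R))
    (p q : Set (PPFormula R n)) : Prop :=
  PPTypeLeOn 𝓛 p q ∧ PPTypeLeOn 𝓛 q p

/-- `f : M → N` is an `𝓛`-pure embedding: it is injective and, for every tuple `a` in `M`, the
pp types of `a` in `M` and in `N` are `𝓛`-equivalent. -/
def IsRelPureEmbedding {R : Type u} [Ring R] (𝓛 : Set (ModuleCat.{v} R))
    {M N : Type v} [AddCommGroup M] [Module R M] [AddCommGroup N] [Module R N]
    (f : M →ₗ[R] N) : Prop :=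
  Function.Injective f ∧
    ∀ (n : ℕ) (a : Fin n → M), PPTypeEquivOn 𝓛 (ppType R a) (ppType R (fun i => f (a i)))

/-! Let `φ` be `∃ y, A x + B y = 0`. In any module `φ` forces `r A x = 0` for each row `r` with `r B
= 0`. In an absolutely pure module this condition also suffices: a consistent system is solvable in
some extension, and purity brings a solution back. By coherence these `r` are generated by the rows
of a finite matrix `C`, so on absolutely pure modules `φ` amounts to `C A x = 0`. Embeddings reflect
such quantifier-free formulas, which gives the nontrivial half of the equivalence. -/

/-- Over a left coherent ring, the kernel of a linear map between finitely generated free modules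
is finitely generated. -/
theorem IsLeftCoherent.fg_ker {R : Type u} [Ring R] (hR : IsLeftCoherent R) (k : ℕ) :
    ∀ (m : ℕ) (g : (Fin m → R) →ₗ[R] (Fin k → R)), (LinearMap.ker g).FG := by
  induction k with
  | zero =>
    intro m g
    have hg : LinearMap.ker g = ⊤ := LinearMap.ker_eq_top.2 (Subsingleton.elim _ _)
    rw [hg]
    exact Module.Finite.fg_top
  | succ k ih =>
    intro m g
    -- The range of the first coordinate `g₀` is a finitely generated left ideal, so coherence makes
    -- `ker g₀` finitely generated. Covering it by a free module via `h` leaves only `k` coordinates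
    -- to kill.
    let g₀ : (Fin m → R) →ₗ[R] R := LinearMap.proj 0 ∘ₗ g
    let tail : (Fin (k + 1) → R) →ₗ[R] (Fin k → R) := LinearMap.funLeft R R Fin.succ
    have hI : (LinearMap.range g₀).FG := by
      rw [LinearMap.range_eq_map]
      exact Module.Finite.fg_top.map g₀
    have : Module.FinitePresentation R (LinearMap.range g₀) := hR _ hI
    have hg₀ : (LinearMap.ker g₀).FG := by
      rw [← LinearMap.ker_rangeRestrict]
      exact Module.FinitePresentation.fg_ker _ g₀.surjective_rangeRestrict
    obtain ⟨m', h, hh⟩ := (Submodule.fg_iff_exists_fin_linearMap R _).1 hg₀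
    have hker : LinearMap.ker g = (LinearMap.ker (tail ∘ₗ g ∘ₗ h)).map h := by
      ext r
      simp only [Submodule.mem_map, LinearMap.mem_ker]
      constructor
      · intro hr
        have : r ∈ LinearMap.range h := by
          rw [hh]
          simp [g₀, hr]
        obtain ⟨s, rfl⟩ := this
        exact ⟨s, by simp [hr], rfl⟩
      · rintro ⟨s, hs, rfl⟩
        have h0 : h s ∈ LinearMap.ker g₀ := hh ▸ LinearMap.mem_range_self h s
        ext j
        refine Fin.cases ?_ (fun j => ?_) j
        · exact h0
        · exact congrFun hs j
    rw [hker]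
    exact (ih m' _).map h

/-- Over a left coherent ring, the left annihilator of a finite matrix is generated by finitely
many rows. -/
theorem IsLeftCoherent.exists_rows {R : Type u} [Ring R] (hR : IsLeftCoherent R) {m k : ℕ}
    (B : Matrix (Fin m) (Fin k) R) :
    ∃ (l : ℕ) (C : Matrix (Fin l) (Fin m) R), C * B = 0 ∧
      ∀ r : Fin m → R, (∀ j, ∑ i, r i * B i j = 0) → r ∈ Submodule.span R (Set.range C) := by
  let g : (Fin m → R) →ₗ[R] (Fin k → R) := Fintype.linearCombination R fun i => B i
  have hg : ∀ r j, g r j = ∑ i, r i * B i j := fun r j => by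
    simp [g, Fintype.linearCombination_apply]
  obtain ⟨l, C, hC⟩ := Submodule.fg_iff_exists_fin_generating_family.1 (hR.fg_ker k m g)
  refine ⟨l, C, ?_, fun r hr => hC ▸ LinearMap.mem_ker.2 (funext fun j => (hg r j).trans (hr j))⟩
  ext p j
  have hp : C p ∈ LinearMap.ker g := hC ▸ Submodule.subset_span (Set.mem_range_self p)
  exact (hg (C p) j).symm.trans (congrFun (LinearMap.mem_ker.1 hp) j)

/-- A finite system of linear equations over a module which is consistent, in the sense that every
linear relation between the left-hand sides holds between the right-hand sides, has a solution in
some extension of the module. -/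
theorem exists_extension_solution {R : Type u} [Ring R] [Small.{v} R] {L : Type v}
    [AddCommGroup L] [Module R L] {m k : ℕ} (B : Matrix (Fin m) (Fin k) R) (b : Fin m → L)
    (hb : ∀ r : Fin m → R, (∀ j, ∑ i, r i * B i j = 0) → ∑ i, r i • b i = 0) :
    ∃ (N : ModuleCat.{v} R) (f : L →ₗ[R] N), Function.Injective f ∧
      ∃ y : Fin k → N, ∀ i, f (b i) + ∑ j, B i j • y j = 0 := by
  let e : Shrink.{v} R ≃ₗ[R] R := Shrink.linearEquiv R R
  let w : Fin m → L × (Fin k → Shrink.{v} R) := fun i => (b i, fun j => e.symm (B i j))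
  let S := LinearMap.range (Fintype.linearCombination R w)
  -- Adjoin free generators `y j` to `L` and impose the equations as the relations `S`; `Shrink`
  -- keeps the module in universe `v`. Consistency `hb` says exactly that `S` meets `L` trivially.
  refine ⟨ModuleCat.of R ((L × (Fin k → Shrink.{v} R)) ⧸ S),
    S.mkQ ∘ₗ LinearMap.inl R L (Fin k → Shrink.{v} R), ?_,
    fun j => S.mkQ (0, Pi.single j (e.symm 1)), fun i => ?_⟩
  · refine (injective_iff_map_eq_zero _).2 fun x hx => ?_
    have hx' : (x, 0) ∈ S := (Submodule.Quotient.mk_eq_zero S).1 hx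
    obtain ⟨r, hr⟩ := hx'
    rw [Fintype.linearCombination_apply] at hr
    have h1 : ∑ i, r i • b i = x := by
      simpa [w, Prod.fst_sum] using congrArg Prod.fst hr
    rw [← h1]
    refine hb r fun j => ?_
    have h2 := congrArg e (congrFun (congrArg Prod.snd hr) j)
    simpa [w, Prod.snd_sum] using h2
  · have hw : (b i, (0 : Fin k → Shrink.{v} R)) + ∑ j, B i j • (0, Pi.single j (e.symm 1)) =
        w i := by
      refine Prod.ext ?_ (funext fun j => ?_)
      · simp [w, Prod.fst_sum]
      · simp [w, Prod.snd_sum, Pi.single_apply, ← map_smul]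
    have hS : S.mkQ (w i) = 0 := by
      refine (Submodule.Quotient.mk_eq_zero S).2 ⟨Pi.single i 1, ?_⟩
      simp [Fintype.linearCombination_apply_single]
    rw [← hw, map_add, map_sum] at hS
    simp only [map_smul] at hS
    exact hS

/-- An absolutely pure module contains a solution of every consistent finite system of linear
equations. -/
theorem exists_solution_of_mem_absolutelyPureModules {R : Type u} [Ring R] [Small.{v} R]
    {L : ModuleCat.{v} R} (hL : L ∈ absolutelyPureModules.{u, v} R) {m k : ℕ}
    (B : Matrix (Fin m) (Fin k) R) (b : Fin m → L)
    (hb : ∀ r : Fin m → R, (∀ j, ∑ i, r i * B i j = 0) → ∑ i, r i • b i = 0) :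
    ∃ y : Fin k → L, ∀ i, b i + ∑ j, B i j • y j = 0 := by
  obtain ⟨N, f, hf, y, hy⟩ := exists_extension_solution B b hb
  -- The coefficient matrix `1` makes the right-hand sides `b` themselves the free variables.
  obtain ⟨z, hz⟩ := (hL N f hf).2 m b ⟨k, m, 1, B⟩
    ⟨y, fun i => by simpa [Matrix.one_apply, ite_smul] using hy i⟩
  exact ⟨z, fun i => by simpa [Matrix.one_apply, ite_smul] using hz i⟩

/-- Over a left coherent ring, every pp formula is equivalent on the absolutely pure modules to
a quantifier-free one, which it implies in every module. -/
theorem IsLeftCoherent.exists_quantifierFree {R : Type u} [Ring R] [Small.{v} R]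
    (hR : IsLeftCoherent R) {n : ℕ} (φ : PPFormula R n) :
    ∃ (l : ℕ) (D : Matrix (Fin l) (Fin n) R),
      (∀ (N : Type v) [AddCommGroup N] [Module R N] (x : Fin n → N), φ.Holds x →
        ∀ p, ∑ j, D p j • x j = 0) ∧
      ∀ L ∈ absolutelyPureModules.{u, v} R, ∀ x : Fin n → L,
        (∀ p, ∑ j, D p j • x j = 0) → φ.Holds x := by
  obtain ⟨l, C, hCB, hC⟩ := hR.exists_rows φ.B
  have assoc : ∀ {N : Type v} [AddCommGroup N] [Module R N] {q : ℕ} (r : Fin φ.numEq → R)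
      (A : Matrix (Fin φ.numEq) (Fin q) R) (x : Fin q → N),
      ∑ i, r i • ∑ j, A i j • x j = ∑ j, (∑ i, r i * A i j) • x j := by
    intro N _ _ q r A x
    simp only [Finset.smul_sum, Finset.sum_smul, smul_smul]
    exact Finset.sum_comm
  refine ⟨l, C * φ.A, ?_, ?_⟩
  · rintro N _ _ x ⟨y, hy⟩ p
    have h : ∑ i, C p i • (∑ j, φ.A i j • x j + ∑ k, φ.B i k • y k) = 0 := by simp [hy]
    have hB : ∀ k, ∑ i, C p i * φ.B i k = 0 := fun k => congrFun (congrFun hCB p) k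
    simpa [smul_add, Finset.sum_add_distrib, assoc, hB, Matrix.mul_apply] using h
  · intro L hL x hx
    refine exists_solution_of_mem_absolutelyPureModules hL φ.B (fun i => ∑ j, φ.A i j • x j)
      fun r hr => ?_
    let g : (Fin φ.numEq → R) →ₗ[R] L :=
      Fintype.linearCombination R fun i => ∑ j, φ.A i j • x j
    have hle : Submodule.span R (Set.range C) ≤ LinearMap.ker g := by
      refine Submodule.span_le.2 ?_
      rintro _ ⟨p, rfl⟩
      have h := hx p
      simp only [Matrix.mul_apply] at h
      exact (assoc (C p) φ.A x).trans h
    exact hle (hC r hr)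

/-- Linear maps preserve pp formulas. -/
theorem PPFormula.Holds.map {R : Type u} [Ring R] {n : ℕ} {φ : PPFormula R n} {M N : Type v}
    [AddCommGroup M] [Module R M] [AddCommGroup N] [Module R N] (f : M →ₗ[R] N)
    {x : Fin n → M} (h : φ.Holds x) : φ.Holds fun i => f (x i) := by
  obtain ⟨y, hy⟩ := h
  exact ⟨fun k => f (y k), fun i => by simpa using congrArg f (hy i)⟩

theorem mainTheorem7 (R : Type u) [Ring R] [Small.{v} R] (hR : IsLeftCoherent R)
    (M N : Type v) [AddCommGroup M] [Module R M] [AddCommGroup N] [Module R N]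
    (f : M →ₗ[R] N) (hf : Function.Injective f) :
    IsRelPureEmbedding (absolutelyPureModules.{u, v} R) f := by
  refine ⟨hf, fun n a => ⟨fun φ hφ => ?_, fun φ hφ => ⟨φ, hφ.map f, fun _ _ _ h => h⟩⟩⟩
  obtain ⟨l, D, hD, hL⟩ := hR.exists_quantifierFree φ
  -- The witness is `D x = 0`, with no quantified variables: it holds at `f a` in `N`, hence at `a`
  -- by injectivity, and implies `φ` on absolutely pure modules.
  refine ⟨⟨0, l, D, 0⟩, ⟨0, fun p => ?_⟩, fun L hLp x hx => hL L hLp x fun p => ?_⟩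
  · have h : f (∑ j, D p j • a j) = 0 := by simpa using hD N _ hφ p
    simpa using hf (h.trans (map_zero f).symm)
  · obtain ⟨y, hy⟩ := hx
    simpa using hy p
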